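/- Let $\mathbb F$ be a finite field and let $r, m \ge 1$ be integers. Upper indices $k$ are taken modulo $r$, and $\delta_{k,r}=1$ if $k \equiv r \pmod r$ and $\delta_{k,r}=0$ otherwise. Write $c_k := \delta_{k,r}m$. Let $\mathcal C = \mathcal C(r,m)$ be the following $\mathbb F$-linear category. Let $\Gamma$ be the quiver with vertices $X_{i,j}^{(k)}$ ($i \le j$ integers) and $Z_i^{(k)}$ ($i \in \mathbb Z$), and with the following arrows, each having a degree: * $\alpha_{(s,t),(i,j)}^{(k)} : X_{i,j}^{(k)} \to X_{s,t}^{(k)}$ for $s \in [i,j]$, $t \ge j$ (degree $0$); * $\beta_{s,(i,j)}^{(k)} : X_{i,j}^{(k)} \to Z_s^{(k)}$ for $s \in [i,j]$ (degree $1$); * $\gamma_{(s,t),(i,j)}^{(k)} : X_{i,j}^{(k)} \to X_{s,t}^{(k+1)}$ for $s \le i + c_k - 1$, $t \in [i+c_k-1, j+c_k-1]$ (degree $2$); * $\alpha_{s,i}'^{(k)} : Z_i^{(k)} \to Z_s^{(k)}$ for $s \ge i$ (degree $0$); * $\beta_{(s,t),i}'^{(k)} : Z_i^{(k)} \to X_{s,t}^{(k+1)}$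 for $s \le i + c_k - 1 \le t$ (degree $1$). The objects of $\mathcal C$ are the finite formal direct sums of vertices of $\Gamma$. The morphisms are matrices of $\mathbb F$-linear combinations of paths modulo the relations: $\alpha_{(i,j),(i,j)}^{(k)}$ and $\alpha_{i,i}'^{(k)}$ are identities; and for arrows $f : X \to Y$ and $g : Y \to W$ of degrees $d$ and $d'$, the composite $g \circ f$ is the arrow $X \to W$ of degree $d+d'$ if there is one, and $0$ otherwise. Put $X_{i,i-1}^{(k)} := 0$. Assume that $\mathcal C$ carries a triangulated structure whose suspension satisfies $\Sigma X_{i,j}^{(k)} \simeq X_{i+c_k,\,j+c_k}^{(k+1)}$ and $\Sigma Z_i^{(k)} \simeq Z_{i+c_k}^{(k+1)}$ for all $k$ and $i \le j$. Let $k$ be an upper index, $i \in \mathbb Z$, $n \ge 0$, and let $s_n < \dots < s_1$ and $t_1 < \dots < t_n$ be integers with $s_1 \le i + c_k - 1 \le t_1$ (no condition if $n = 0$). Put $s_0 := i + c_k$, and let $$f_{\mathbf s,\mathbf t,i}^{(k)} : Z_i^{(k)} \to \bigoplus_{p=1}^n X_{s_p,t_p}^{(k+1)}$$ be the map whose $p$-th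 component is $\beta_{(s_p,t_p),i}'^{(k)}$. Then: 1. $\operatorname{cone}\bigl(f_{\mathbf s,\mathbf t,i}^{(k)}\bigr) \simeq \Bigl(\bigoplus_{p=1}^n X_{s_{p-1},t_p}^{(k+1)}\Bigr) \oplus Z_{s_n}^{(k+1)}$. 2. Let $j \ge i$ be an integer with $t_n < j + c_k - 1$ (no condition on $t_n$ if $n = 0$), put $t_{n+1} := j + c_k - 1$, and let $$f_{\mathbf s,\mathbf t,j,i}'^{(k)} : Z_i^{(k)} \to \Bigl(\bigoplus_{p=1}^n X_{s_p,t_p}^{(k+1)}\Bigr) \oplus Z_j^{(k)}$$ be the map with components $f_{\mathbf s,\mathbf t,i}^{(k)}$ and $\alpha_{j,i}'^{(k)}$. Then $\operatorname{cone}\bigl(f_{\mathbf s,\mathbf t,j,i}'^{(k)}\bigr) \simeq \bigoplus_{p=1}^{n+1} X_{s_{p-1},t_p}^{(k+1)}$. -/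

import Mathlib

open CategoryTheory CategoryTheory.Limits CategoryTheory.Pretriangulated

namespace DiscreteHall

universe u

/-- The vertices of the quiver `Γ`: `X k i j` is `X_{i,j}^{(k)}` (with `i ≤ j`) and `Z k i` is
`Z_i^{(k)}`.  The upper index is computed modulo `r`, so it is an element of `ZMod r`; the residue
class of `r` is `0`.  The parameters `F` and `m` only serve to attach the category structure below
to this type. -/
inductive Vtx (F : Type u) (r m : ℕ) : Type
  | X (k : ZMod r) (i j : ℤ) (h : i ≤ j) : Vtx F r m
  | Z (k : ZMod r) (i : ℤ) : Vtx F r m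

/-- The number `δ_{k,r} m`. -/
def del {r : ℕ} (m : ℕ) (k : ZMod r) : ℤ := if k = 0 then (m : ℤ) else 0

section Quiver

variable {F : Type u} {r m : ℕ}

/-- `HasArrow x y d` says that `Γ` has an arrow `x → y` of degree `d`.  There is at most one such
arrow.  In the order of the cases these are the arrows
`α : X_{i,j}^{(k)} → X_{s,t}^{(k)}`, `β : X_{i,j}^{(k)} → Z_s^{(k)}`,
`γ : X_{i,j}^{(k)} → X_{s,t}^{(k+1)}`, `α' : Z_i^{(k)} → Z_s^{(k)}` and
`β' : Z_i^{(k)} → X_{s,t}^{(k+1)}`. -/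
def HasArrow : Vtx F r m → Vtx F r m → ℕ → Prop
  | .X k i j _, .X l s t _, 0 => l = k ∧ i ≤ s ∧ s ≤ j ∧ j ≤ t
  | .X k i j _, .Z l s, 1 => l = k ∧ i ≤ s ∧ s ≤ j
  | .X k i j _, .X l s t _, 2 =>
      l = k + 1 ∧ s ≤ i + del m k - 1 ∧ i + del m k - 1 ≤ t ∧ t ≤ j + del m k - 1
  | .Z k i, .Z l s, 0 => l = k ∧ i ≤ s
  | .Z k i, .X l s t _, 1 => l = k + 1 ∧ s ≤ i + del m k - 1 ∧ i + del m k - 1 ≤ t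
  | _, _, _ => False

/-- The arrows `x → y` of `Γ`, each given by its degree. -/
structure Arrow (x y : Vtx F r m) : Type where
  deg : ℕ
  has : HasArrow x y deg

lemma hasArrow_refl (x : Vtx F r m) : HasArrow x x 0 := by
  cases x with
  | X k i j h => exact ⟨rfl, le_rfl, h, le_rfl⟩
  | Z k i => exact ⟨rfl, le_rfl⟩

/-- The relations are consistent: if the product of three arrows has a degree in which there is an
arrow, then the same holds for the two partial products. -/
lemma hasArrow_partial {x y z w : Vtx F r m} {a b c : ℕ} (f : HasArrow x y a)
    (g : HasArrow y z b) (h : HasArrow z w c) (H : HasArrow x w (a + b + c)) :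
    HasArrow x z (a + b) ∧ HasArrow y w (b + c) := by
  rcases x with ⟨k, i, j, hij⟩ | ⟨k, i⟩ <;> rcases y with ⟨k', i', j', hij'⟩ | ⟨k', i'⟩ <;>
    rcases z with ⟨k'', i'', j'', hij''⟩ | ⟨k'', i''⟩ <;>
    rcases w with ⟨k₃, i₃, j₃, hij₃⟩ | ⟨k₃, i₃⟩ <;>
    rcases a with _ | _ | _ | a <;> simp only [HasArrow] at f <;>
    rcases b with _ | _ | _ | b <;> simp only [HasArrow] at g <;>
    rcases c with _ | _ | _ | c <;> simp only [HasArrow] at h <;>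
    simp only [HasArrow, Nat.reduceAdd, zero_add, add_zero] at H ⊢ <;>
    (obtain ⟨rfl, f⟩ := f; obtain ⟨rfl, g⟩ := g; obtain ⟨rfl, h⟩ := h; simp only [true_and]; omega)

end Quiver

noncomputable section

open Classical in
/-- The product of two arrows `f : x → y` and `g : y → z` of degrees `d` and `d'`: it is the arrow
`x → z` of degree `d + d'` if there is one, and `0` otherwise. -/
def mulArrow {F : Type u} [Field F] {r m : ℕ} {x y z : Vtx F r m} (f : Arrow x y)
    (g : Arrow y z) : Arrow x z →₀ F :=
  if h : HasArrow x z (f.deg + g.deg) then Finsupp.single ⟨f.deg + g.deg, h⟩ 1 else 0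

/-- Composition of linear combinations of arrows: the bilinear extension of `mulArrow`. -/
def compL {F : Type u} [Field F] {r m : ℕ} (x y z : Vtx F r m) :
    (Arrow x y →₀ F) →ₗ[F] (Arrow y z →₀ F) →ₗ[F] (Arrow x z →₀ F) :=
  Finsupp.linearCombination F fun f => Finsupp.linearCombination F fun g => mulArrow f g

lemma compL_single {F : Type u} [Field F] {r m : ℕ} {x y z : Vtx F r m} (f : Arrow x y)
    (g : Arrow y z) (a b : F) :
    compL x y z (Finsupp.single f a) (Finsupp.single g b) = (a * b) • mulArrow f g := by
  simp [compL, mul_smul]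

lemma compL_assoc {F : Type u} [Field F] {r m : ℕ} {x y z w : Vtx F r m} (f : Arrow x y →₀ F)
    (g : Arrow y z →₀ F) (h : Arrow z w →₀ F) :
    compL x z w (compL x y z f g) h = compL x y w f (compL y z w g h) := by
  induction f using Finsupp.induction_linear with
  | zero => simp
  | add f f' hf hf' => simp [hf, hf']
  | single f a =>
    induction g using Finsupp.induction_linear with
    | zero => simp
    | add g g' hg hg' => simp [hg, hg']
    | single g b =>
      induction h using Finsupp.induction_linear with
      | zero => simp
      | add h h' hh hh' => simp [hh, hh']
      | single h c =>
        by_cases H : HasArrow x w (f.deg + g.deg + h.deg)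
        · obtain ⟨h1, h2⟩ := hasArrow_partial f.has g.has h.has H
          have H' : HasArrow x w (f.deg + (g.deg + h.deg)) := by rwa [← add_assoc]
          have e1 : mulArrow (F := F) f g = Finsupp.single ⟨_, h1⟩ 1 := dif_pos h1
          have e2 : mulArrow (F := F) g h = Finsupp.single ⟨_, h2⟩ 1 := dif_pos h2
          have e3 : mulArrow (F := F) ⟨_, h1⟩ h = Finsupp.single ⟨_, H⟩ 1 := dif_pos H
          have e4 : mulArrow (F := F) f ⟨_, h2⟩ = Finsupp.single ⟨_, H'⟩ 1 := dif_pos H'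
          simp only [compL_single, map_smul, LinearMap.smul_apply, e1, e2, e3, e4, add_assoc,
            smul_smul, one_mul, mul_one]
          congr 1
          ring
        · have H' : ¬ HasArrow x w (f.deg + (g.deg + h.deg)) := by rwa [← add_assoc]
          have e1 : compL x z w (mulArrow f g) (Finsupp.single h c) = 0 := by
            by_cases h1 : HasArrow x z (f.deg + g.deg)
            · have e1 : mulArrow (F := F) f g = Finsupp.single ⟨_, h1⟩ 1 := dif_pos h1
              have e3 : mulArrow (F := F) ⟨_, h1⟩ h = 0 := dif_neg H
              rw [e1, compL_single, e3, smul_zero]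
            · simp [mulArrow, h1]
          have e2 : compL x y w (Finsupp.single f a) (mulArrow g h) = 0 := by
            by_cases h2 : HasArrow y w (g.deg + h.deg)
            · have e2 : mulArrow (F := F) g h = Finsupp.single ⟨_, h2⟩ 1 := dif_pos h2
              have e4 : mulArrow (F := F) f ⟨_, h2⟩ = 0 := dif_neg H'
              rw [e2, compL_single, e4, smul_zero]
            · simp [mulArrow, h2]
          simp [compL_single, e1, e2]

lemma id_compL {F : Type u} [Field F] {r m : ℕ} {x y : Vtx F r m} (f : Arrow x y →₀ F) :
    compL x x y (Finsupp.single ⟨0, hasArrow_refl x⟩ 1) f = f := by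
  induction f using Finsupp.induction_linear with
  | zero => simp
  | add f f' hf hf' => rw [map_add, hf, hf']
  | single f a =>
    obtain ⟨d, h⟩ := f
    simp [compL_single, mulArrow, h]

lemma compL_id {F : Type u} [Field F] {r m : ℕ} {x y : Vtx F r m} (f : Arrow x y →₀ F) :
    compL x y y f (Finsupp.single ⟨0, hasArrow_refl y⟩ 1) = f := by
  induction f using Finsupp.induction_linear with
  | zero => simp
  | add f f' hf hf' => rw [map_add, LinearMap.add_apply, hf, hf']
  | single f a =>
    obtain ⟨d, h⟩ := f
    simp [compL_single, mulArrow, h]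

variable (F : Type u) [Field F] (r m : ℕ)

/-- The `F`-linear path category of `Γ` modulo the relations: its objects are the vertices of `Γ`,
the arrows `x → y` form a basis of `x ⟶ y`, the arrows `α_{(i,j),(i,j)}^{(k)}` and
`α'_{i,i}^{(k)}` are the identities and the composite of two arrows is given by `mulArrow`. -/
instance : Category.{u} (Vtx F r m) where
  Hom x y := Arrow x y →₀ F
  id x := Finsupp.single ⟨0, hasArrow_refl x⟩ 1
  comp {x y z} f g := compL x y z f g
  id_comp f := id_compL f
  comp_id f := compL_id f
  assoc f g h := compL_assoc f g h

instance : Preadditive (Vtx F r m) where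
  homGroup x y := inferInstanceAs (AddCommGroup (Arrow x y →₀ F))
  add_comp x y z f f' g := LinearMap.map_add₂ (compL (F := F) x y z) f f' g
  comp_add x y z f g g' := (compL (F := F) x y z f).map_add g g'

instance : Linear F (Vtx F r m) where
  homModule x y := inferInstanceAs (Module F (Arrow x y →₀ F))
  smul_comp x y z a f g := LinearMap.map_smul₂ (compL (F := F) x y z) a f g
  comp_smul x y z f a g := (compL (F := F) x y z f).map_smul a g

variable {F r m}

/-- The arrow `x → y` of degree `d`, as a morphism of the path category modulo relations. -/
def arr {x y : Vtx F r m} {d : ℕ} (h : HasArrow x y d) : x ⟶ y :=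
  (Finsupp.single (⟨d, h⟩ : Arrow x y) 1 : Arrow x y →₀ F)

/-- The universal property of the path category modulo relations: vertices and arrows in an
`F`-linear category `D` that satisfy the defining relations extend to an `F`-linear functor. -/
def lift {D : Type*} [Category D] [Preadditive D] [Linear F D] (o : Vtx F r m → D)
    (φ : ∀ {x y : Vtx F r m} {d : ℕ}, HasArrow x y d → (o x ⟶ o y))
    (hid : ∀ x, φ (hasArrow_refl x) = 𝟙 (o x))
    (hcomp : ∀ {x y z : Vtx F r m} {d e : ℕ} (f : HasArrow x y d) (g : HasArrow y z e)
      (h : HasArrow x z (d + e)), φ f ≫ φ g = φ h)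
    (hzero : ∀ {x y z : Vtx F r m} {d e : ℕ} (f : HasArrow x y d) (g : HasArrow y z e),
      ¬ HasArrow x z (d + e) → φ f ≫ φ g = 0) : Vtx F r m ⥤ D where
  obj := o
  map {x y} f := Finsupp.linearCombination F (fun a : Arrow x y => φ a.has) f
  map_id x := by
    change Finsupp.linearCombination F (fun a : Arrow x x => φ a.has)
      (Finsupp.single ⟨0, hasArrow_refl x⟩ 1) = _
    simp [hid]
  map_comp {x y z} f g := by
    change Finsupp.linearCombination F (fun a : Arrow x z => φ a.has) (compL x y z f g) = _
    induction f using Finsupp.induction_linear with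
    | zero => simp
    | add f f' hf hf' =>
      rw [map_add, LinearMap.add_apply, map_add, hf, hf', map_add, Preadditive.add_comp]
    | single f a =>
      induction g using Finsupp.induction_linear with
      | zero => simp
      | add g g' hg hg' => rw [map_add, map_add, hg, hg', map_add, Preadditive.comp_add]
      | single g b =>
        by_cases h : HasArrow x z (f.deg + g.deg)
        · have e : mulArrow (F := F) f g = Finsupp.single ⟨_, h⟩ 1 := dif_pos h
          simp only [compL_single, e, map_smul, Finsupp.linearCombination_single, one_smul,
            Linear.smul_comp, Linear.comp_smul, hcomp f.has g.has h, smul_smul]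
          rw [mul_comm]
        · have e : mulArrow (F := F) f g = 0 := dif_neg h
          simp [compL_single, e, hzero f.has g.has h]

lemma lift_map_arr {D : Type*} [Category D] [Preadditive D] [Linear F D] (o : Vtx F r m → D)
    (φ : ∀ {x y : Vtx F r m} {d : ℕ}, HasArrow x y d → (o x ⟶ o y)) (hid) (hcomp) (hzero)
    {x y : Vtx F r m} {d : ℕ} (h : HasArrow x y d) :
    (lift o φ hid hcomp hzero).map (arr h) = φ h := by
  change Finsupp.linearCombination F (fun a : Arrow x y => φ a.has) (Finsupp.single ⟨d, h⟩ 1) = _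
  simp

variable (F r m)

/-- The category `C(r, m)`: its objects are the formal (finite) direct sums of vertices of `Γ`, its
morphisms are the matrices of morphisms of the path category modulo relations. -/
abbrev CatC : Type 1 := Mat_ (Vtx F r m)

instance : HasBinaryBiproducts (CatC F r m) := hasBinaryBiproducts_of_finite_biproducts _

variable {F r m}

/-- A vertex, as an object of `C(r, m)`. -/
abbrev vtx (x : Vtx F r m) : CatC F r m := (Mat_.embedding (Vtx F r m)).obj x

/-- The arrow `x → y` of degree `d`, as a morphism of `C(r, m)`. -/
abbrev arrC {x y : Vtx F r m} {d : ℕ} (h : HasArrow x y d) : vtx x ⟶ vtx y :=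
  (Mat_.embedding (Vtx F r m)).map (arr h)

variable (F m)

open scoped ZeroObject in
/-- The object `X_{i,j}^{(k)}` of `C(r, m)`, which is `0` if `j < i` (this is needed only for
`j = i - 1`). -/
def objX (k : ZMod r) (i j : ℤ) : CatC F r m :=
  if h : i ≤ j then vtx (.X k i j h) else 0

/-- The object `Z_i^{(k)}` of `C(r, m)`. -/
abbrev objZ (k : ZMod r) (i : ℤ) : CatC F r m := vtx (.Z k i)

/-- The object `X_{s_1,t_1}^{(k+1)} ⊕ ⋯ ⊕ X_{s_n,t_n}^{(k+1)}`, where all `s_p ≤ t_p`. -/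
abbrev sumX (k : ZMod r) {n : ℕ} (s t : Fin n → ℤ) (h : ∀ p, s p ≤ t p) : CatC F r m :=
  ⨁ fun p : Fin n => (vtx (Vtx.X (k + 1) (s p) (t p) (h p)) : CatC F r m)

/-- The map `f_{s,t,i}^{(k)} : Z_i^{(k)} → ⨁ X_{s_p,t_p}^{(k+1)}` whose `p`-th component is the
arrow `β'`.  (The entries `s_1, …, s_n` and `t_1, …, t_n` are indexed by `Fin n`.) -/
def fMap (k : ZMod r) (i : ℤ) {n : ℕ} (s t : Fin n → ℤ)
    (hs : ∀ p, s p ≤ i + del m k - 1) (ht : ∀ p, i + del m k - 1 ≤ t p) :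
    objZ F m k i ⟶ sumX F m k s t (fun p => (hs p).trans (ht p)) :=
  biproduct.lift fun p => arrC (d := 1) ⟨rfl, hs p, ht p⟩

/-- The map `f'_{s,t,j,i}^{(k)} : Z_i^{(k)} → (⨁ X_{s_p,t_p}^{(k+1)}) ⊕ Z_j^{(k)}` which extends
`f_{s,t,i}^{(k)}` by the arrow `α' : Z_i^{(k)} → Z_j^{(k)}`. -/
def fMap' (k : ZMod r) (i j : ℤ) (hj : i ≤ j) {n : ℕ} (s t : Fin n → ℤ)
    (hs : ∀ p, s p ≤ i + del m k - 1) (ht : ∀ p, i + del m k - 1 ≤ t p) :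
    objZ F m k i ⟶ sumX F m k s t (fun p => (hs p).trans (ht p)) ⊞ objZ F m k j :=
  biprod.lift (fMap F m k i s t hs ht) (arrC (x := .Z k i) (y := .Z k j) (d := 0) ⟨rfl, hj⟩)

/-- `W` is a cone of `f`: there is an exact triangle `A --f--> B → W → Σ A`. -/
def IsConeOf {C : Type*} [Category C] [Preadditive C] [HasZeroObject C] [HasShift C ℤ]
    [∀ n : ℤ, (shiftFunctor C n).Additive] [Pretriangulated C] {A B : C} (f : A ⟶ B) (W : C) :
    Prop :=
  ∃ (g : B ⟶ W) (h : W ⟶ A⟦(1 : ℤ)⟧), Triangle.mk f g h ∈ distTriang C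

end

end DiscreteHall

/-! An object of the category is determined up to isomorphism by the dimensions of the morphism
spaces into it from the vertices, and these dimensions can be computed for a cone without
constructing any map. Let `A → B → W → ΣA` be exact with first map `f`. The long exact sequence of
`Hom(ΣY, -)` gives dim Hom(ΣY, W) + rk f(ΣY) + rk f(Y) = dim Hom(ΣY, B) + dim Hom(Y, A), where rk
f(Y) is the rank of `f` on `Hom(Y, -)`. Since the field is finite, dimensions are read off from
cardinalities. As the suspension permutes the vertices, it suffices to check that the proposed cone
satisfies this equation (`isConeOf_of_hdim`).

Reconstruction (`nonempty_iso_of_hdim_eq`): a second difference of `Hom(X_{i,j}, -)` detects exactly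
`X_{i,j}` and its suspension, so a finitely supported discrepancy of multiplicities changes sign
along each suspension orbit. These orbits are infinite because `m ≥ 1`, hence the discrepancy
vanishes on the `X`; first differences of `Hom(Z_i, -)` then settle the `Z`.

The numerical identity: with `c = c_k`, `arrowsToX_add_rankTerm` is the count for the case `n = 0`
of part 2, a cone `X_{S,T}^{(k+1)}` of `Z_{S-c}^{(k)} → Z_{T+1-c}^{(k)}`. Subtracting the instance
`(s_p, t_p)` from `(s_{p-1}, t_p)` cancels what depends on `t_p`, and the rest telescopes in `p`.
The ranks of the two maps are sums of the same differences (`homRank_fMap`, `homRank_fMap'`). -/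

namespace DiscreteHall

universe u

/-! ### Counting morphisms in exact triangles -/

section Counting

lemma rightComp_apply {C : Type*} [Category C] [Preadditive C] (P : C) {Q R : C} (g : Q ⟶ R)
    (f : P ⟶ Q) : Preadditive.rightComp P g f = f ≫ g := rfl

lemma card_hom_biproduct {C : Type*} [Category C] [HasZeroMorphisms C] {J : Type} [Fintype J]
    (A : C) (f : J → C) [HasBiproduct f] :
    Nat.card (A ⟶ ⨁ f) = ∏ j, Nat.card (A ⟶ f j) := by
  rw [← Nat.card_pi]
  exact Nat.card_congr
    { toFun := fun g j => g ≫ biproduct.π f j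
      invFun := fun g => biproduct.lift g
      left_inv := fun g => by ext; simp
      right_inv := fun g => by ext; simp }

lemma card_eq_card_ker_mul_card_range {G H : Type*} [AddGroup G] [AddGroup H] (φ : G →+ H) :
    Nat.card G = Nat.card φ.ker * Nat.card φ.range := by
  rw [← Nat.card_congr (QuotientAddGroup.quotientKerEquivRange φ).toEquiv, mul_comm]
  exact AddSubgroup.card_eq_card_quotient_mul_card_addSubgroup _

/-- The number of morphisms from `Y⟦1⟧` to the third object of an exact triangle, in terms of the
first map. -/
lemma card_hom_shift_cone {C : Type*} [Category C] [Preadditive C] [HasZeroObject C]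
    [HasShift C ℤ] [∀ n : ℤ, (shiftFunctor C n).Additive] [Pretriangulated C] {A B W : C}
    {f : A ⟶ B} {g : B ⟶ W} {h : W ⟶ A⟦(1 : ℤ)⟧} (hT : Triangle.mk f g h ∈ distTriang C) (Y : C) :
    Nat.card (Y⟦(1 : ℤ)⟧ ⟶ W) * Nat.card (Preadditive.rightComp (Y⟦(1 : ℤ)⟧) f).range *
      Nat.card (Preadditive.rightComp Y f).range =
      Nat.card (Y⟦(1 : ℤ)⟧ ⟶ B) * Nat.card (Y ⟶ A) := by
  have hfg : f ≫ g = 0 := comp_distTriang_mor_zero₁₂ _ hT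
  have hgh : g ≫ h = 0 := comp_distTriang_mor_zero₂₃ _ hT
  have hhf : h ≫ f⟦(1 : ℤ)⟧' = 0 := comp_distTriang_mor_zero₃₁ _ hT
  have e1 : (Preadditive.rightComp (Y⟦(1 : ℤ)⟧) g).ker =
      (Preadditive.rightComp (Y⟦(1 : ℤ)⟧) f).range := by
    ext x
    simp only [AddMonoidHom.mem_ker, AddMonoidHom.mem_range, rightComp_apply]
    constructor
    · intro hx
      obtain ⟨y, hy⟩ := Triangle.coyoneda_exact₂ _ hT x hx
      exact ⟨y, hy.symm⟩
    · rintro ⟨y, rfl⟩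
      rw [Category.assoc, hfg, comp_zero]
  have e2 : (Preadditive.rightComp (Y⟦(1 : ℤ)⟧) h).ker =
      (Preadditive.rightComp (Y⟦(1 : ℤ)⟧) g).range := by
    ext x
    simp only [AddMonoidHom.mem_ker, AddMonoidHom.mem_range, rightComp_apply]
    constructor
    · intro hx
      obtain ⟨y, hy⟩ := Triangle.coyoneda_exact₃ _ hT x hx
      exact ⟨y, hy.symm⟩
    · rintro ⟨y, rfl⟩
      rw [Category.assoc, hgh, comp_zero]
  have e3 : (Preadditive.rightComp (Y⟦(1 : ℤ)⟧) (f⟦(1 : ℤ)⟧')).ker =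
      (Preadditive.rightComp (Y⟦(1 : ℤ)⟧) h).range := by
    ext x
    simp only [AddMonoidHom.mem_ker, AddMonoidHom.mem_range, rightComp_apply]
    constructor
    · intro hx
      obtain ⟨y, hy⟩ := Triangle.coyoneda_exact₁ _ hT x hx
      exact ⟨y, hy.symm⟩
    · rintro ⟨y, rfl⟩
      rw [Category.assoc, hhf, comp_zero]
  -- The suspension is fully faithful, so the last map of the five-term sequence may be replaced by
  -- `f` on `Hom(Y, -)`.
  have e4 : Nat.card (Preadditive.rightComp Y f).ker =
      Nat.card (Preadditive.rightComp (Y⟦(1 : ℤ)⟧) (f⟦(1 : ℤ)⟧')).ker := by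
    refine Nat.card_congr
      ((Functor.FullyFaithful.ofFullyFaithful (shiftFunctor C (1 : ℤ))).homEquiv.subtypeEquiv ?_)
    intro x
    simp only [AddMonoidHom.mem_ker, rightComp_apply]
    change x ≫ f = 0 ↔ x⟦(1 : ℤ)⟧' ≫ f⟦(1 : ℤ)⟧' = 0
    rw [← Functor.map_comp, Functor.map_eq_zero_iff]
  rw [card_eq_card_ker_mul_card_range (Preadditive.rightComp (Y⟦(1 : ℤ)⟧) g),
    card_eq_card_ker_mul_card_range (Preadditive.rightComp (Y⟦(1 : ℤ)⟧) h),
    card_eq_card_ker_mul_card_range (Preadditive.rightComp Y f), e1, e2, ← e3, e4]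
  ring

lemma card_range_rightComp_congr {C : Type*} [Category C] [Preadditive C] {Y Y' A B : C}
    (e : Y ≅ Y') (f : A ⟶ B) :
    Nat.card (Preadditive.rightComp Y f).range = Nat.card (Preadditive.rightComp Y' f).range := by
  refine Nat.card_congr ((e.homFromEquiv (Z := B)).subtypeEquiv fun x => ?_)
  simp only [AddMonoidHom.mem_range, rightComp_apply]
  constructor
  · rintro ⟨y, rfl⟩
    exact ⟨e.inv ≫ y, by simp⟩
  · rintro ⟨y, hy⟩
    exact ⟨e.hom ≫ y, by simp [hy]⟩

end Counting

/-! ### Dimensions of morphism spaces and multiplicities -/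

section Dimension

variable {F : Type u} {r m : ℕ}

instance (x y : Vtx F r m) : Finite (Arrow x y) := by
  refine Finite.of_injective (β := Fin 3)
    (fun a => ⟨a.deg, ?_⟩) ?_
  · obtain ⟨d, h⟩ := a
    rcases x with ⟨k, i, j, hij⟩ | ⟨k, i⟩ <;> rcases y with ⟨k', i', j', hij'⟩ | ⟨k', i'⟩ <;>
      rcases d with _ | _ | _ | d <;> simp only [HasArrow] at h <;> simp
  · rintro ⟨d, h⟩ ⟨d', h'⟩ e
    simpa using e

variable [Field F]

/-- The dimension of the space of morphisms from a vertex to an object of `C(r, m)`. -/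
noncomputable def hdim (Y : Vtx F r m) (W : CatC F r m) : ℕ := ∑ a, Nat.card (Arrow Y (W.X a))

lemma card_hom_vtx_vtx [Finite F] (x y : Vtx F r m) :
    Nat.card (vtx x ⟶ vtx y) = Nat.card F ^ Nat.card (Arrow x y) := by
  rw [← Nat.card_congr (Functor.FullyFaithful.ofFullyFaithful (Mat_.embedding (Vtx F r m))).homEquiv]
  change Nat.card (Arrow x y →₀ F) = _
  rw [Nat.card_congr Finsupp.equivFunOnFinite, Nat.card_fun]

lemma card_hom [Finite F] (Y : Vtx F r m) (W : CatC F r m) :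
    Nat.card (vtx Y ⟶ W) = Nat.card F ^ hdim Y W := by
  rw [Nat.card_congr ((Mat_.isoBiproductEmbedding W).homToEquiv (Z := vtx Y)), card_hom_biproduct,
    hdim, ← Finset.prod_pow_eq_pow_sum]
  exact Finset.prod_congr rfl fun a _ => card_hom_vtx_vtx _ _

/-- Turns equalities between numbers of morphisms into equalities between dimensions. -/
lemma card_pow_injective [Finite F] : Function.Injective (Nat.card F ^ · : ℕ → ℕ) :=
  Nat.pow_right_injective (Finite.one_lt_card (α := F))

lemma hdim_vtx (x y : Vtx F r m) : hdim x (vtx y) = Nat.card (Arrow x y) := by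
  change ∑ a : PUnit, Nat.card (Arrow x y) = _
  simp

lemma hdim_biproduct [Finite F] (Y : Vtx F r m) {J : Type} [Fintype J] (f : J → CatC F r m)
    [HasBiproduct f] : hdim Y (⨁ f) = ∑ j, hdim Y (f j) := by
  apply card_pow_injective (F := F)
  simp only [← card_hom, card_hom_biproduct, ← Finset.prod_pow_eq_pow_sum]

lemma hdim_biprod [Finite F] (Y : Vtx F r m) (A B : CatC F r m) :
    hdim Y (A ⊞ B) = hdim Y A + hdim Y B := by
  apply card_pow_injective (F := F)
  simp only [pow_add, ← card_hom]
  rw [← Nat.card_prod]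
  exact Nat.card_congr
    { toFun := fun g => (g ≫ biprod.fst, g ≫ biprod.snd)
      invFun := fun g => biprod.lift g.1 g.2
      left_inv := fun g => by apply biprod.hom_ext <;> simp
      right_inv := fun g => Prod.ext (biprod.lift_fst _ _) (biprod.lift_snd _ _) }

lemma hdim_zero [Finite F] (Y : Vtx F r m) {W : CatC F r m} (hW : IsZero W) : hdim Y W = 0 := by
  apply card_pow_injective (F := F)
  simp only [← card_hom, pow_zero]
  have : Subsingleton (vtx Y ⟶ W) := ⟨fun a b => hW.eq_of_tgt a b⟩
  exact Nat.card_unique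

/-- An object of `C(r, m)` is determined by the multiplicities of the vertices in it. -/
lemma nonempty_iso_of_multiplicity_eq {W W' : CatC F r m}
    (h : ∑ a, Finsupp.single (W.X a) (1 : ℤ) = ∑ a, Finsupp.single (W'.X a) 1) :
    Nonempty (W ≅ W') := by
  classical
  have H (v : Vtx F r m) : Nonempty ({a // W.X a = v} ≃ {a // W'.X a = v}) := by
    have hv := DFunLike.congr_fun h v
    simp only [Finsupp.finsetSum_apply, Finsupp.single_apply, Finset.sum_boole, Nat.cast_inj] at hv
    rw [← Fintype.card_eq, Fintype.card_subtype, Fintype.card_subtype, hv]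
  -- The summands are matched vertex by vertex, by gluing bijections between the fibres.
  let E : W.ι ≃ W'.ι := (Equiv.sigmaFiberEquiv W.X).symm.trans
    ((Equiv.sigmaCongrRight fun v => (H v).some).trans (Equiv.sigmaFiberEquiv W'.X))
  have hE (a : W.ι) : W'.X (E a) = W.X a := ((H (W.X a)).some ⟨a, rfl⟩).2
  exact ⟨Mat_.isoBiproductEmbedding W ≪≫
    biproduct.whiskerEquiv E (fun a => eqToIso (by rw [hE])) ≪≫
    (Mat_.isoBiproductEmbedding W').symm⟩

end Dimension

/-! ### Numbers of arrows into a vertex -/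

section Arrows

variable {F : Type u} {r m : ℕ}

/-- The number of arrows `Y → X_{s,t}^{(l)}`, as an integer. -/
def arrowsToX (Y : Vtx F r m) (l : ZMod r) (s t : ℤ) : ℤ :=
  match Y with
  | .X k a b _ => (if l = k ∧ a ≤ s ∧ s ≤ b ∧ b ≤ t then 1 else 0) +
      if l = k + 1 ∧ s ≤ a + del m k - 1 ∧ a + del m k - 1 ≤ t ∧ t ≤ b + del m k - 1 then 1 else 0
  | .Z k a => if l = k + 1 ∧ s ≤ a + del m k - 1 ∧ a + del m k - 1 ≤ t then 1 else 0

/-- The number of arrows `Y → Z_s^{(l)}`, as an integer. -/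
def arrowsToZ (Y : Vtx F r m) (l : ZMod r) (s : ℤ) : ℤ :=
  match Y with
  | .X k a b _ => if l = k ∧ a ≤ s ∧ s ≤ b then 1 else 0
  | .Z k a => if l = k ∧ a ≤ s then 1 else 0

open Classical in
lemma card_arrow (x y : Vtx F r m) :
    (Nat.card (Arrow x y) : ℤ) = ∑ d ∈ Finset.range 3, if HasArrow x y d then 1 else 0 := by
  have e : Arrow x y ≃ {d // d ∈ (Finset.range 3).filter (HasArrow x y)} :=
    { toFun := fun a => ⟨a.deg, by
        obtain ⟨d, h⟩ := a
        simp only [Finset.mem_filter, Finset.mem_range, h, and_true]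
        rcases x with ⟨k, i, j, hij⟩ | ⟨k, i⟩ <;> rcases y with ⟨k', i', j', hij'⟩ | ⟨k', i'⟩ <;>
          rcases d with _ | _ | _ | d <;> simp only [HasArrow] at h <;> simp⟩
      invFun := fun d => ⟨d.1, (Finset.mem_filter.1 d.2).2⟩
      left_inv := fun _ => rfl
      right_inv := fun _ => rfl }
  rw [Nat.card_congr e, Nat.card_eq_fintype_card, Fintype.card_coe, Finset.sum_boole]

lemma card_arrow_X (Y : Vtx F r m) (l : ZMod r) (s t : ℤ) (h : s ≤ t) :
    (Nat.card (Arrow Y (.X l s t h)) : ℤ) = arrowsToX Y l s t := by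
  rw [card_arrow]
  rcases Y with ⟨k, i, j, hij⟩ | ⟨k, i⟩ <;> simp [Finset.sum_range_succ, HasArrow, arrowsToX]

lemma card_arrow_Z (Y : Vtx F r m) (l : ZMod r) (s : ℤ) :
    (Nat.card (Arrow Y (.Z l s)) : ℤ) = arrowsToZ Y l s := by
  rw [card_arrow]
  rcases Y with ⟨k, i, j, hij⟩ | ⟨k, i⟩ <;> simp [Finset.sum_range_succ, HasArrow, arrowsToZ]

/-- This makes the counting formula agree with the convention that `X_{s,t}` is zero for `t < s`. -/
lemma arrowsToX_eq_zero (Y : Vtx F r m) (l : ZMod r) {s t : ℤ} (h : t < s) :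
    arrowsToX Y l s t = 0 := by
  rcases Y with ⟨k, i, j, hij⟩ | ⟨k, i⟩
  · simp only [arrowsToX]
    rw [if_neg (by omega), if_neg (by omega), add_zero]
  · simp only [arrowsToX]
    rw [if_neg (by omega)]

/-- The degree is forced by the type of the source: 1 from an `X`, 0 from a `Z`. Hence morphism
spaces into `Z_i` have dimension at most one and ranks are 0 or 1. -/
lemma hasArrow_Z_unique (Y : Vtx F r m) (k : ZMod r) (i : ℤ) (d e : ℕ)
    (hd : HasArrow Y (.Z k i) d) (he : HasArrow Y (.Z k i) e) : d = e := by
  rcases Y with ⟨k', i', j', hij'⟩ | ⟨k', i'⟩ <;> rcases d with _ | _ | d <;>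
    rcases e with _ | _ | e <;> simp only [HasArrow] at hd he <;> rfl

variable [Field F]

lemma hdim_objX [Finite F] (Y : Vtx F r m) (l : ZMod r) (s t : ℤ) :
    (hdim Y (objX F m l s t) : ℤ) = arrowsToX Y l s t := by
  by_cases h : s ≤ t
  · rw [objX, dif_pos h, hdim_vtx, card_arrow_X]
  · rw [objX, dif_neg h, hdim_zero Y (isZero_zero _), arrowsToX_eq_zero Y l (not_le.1 h),
      Nat.cast_zero]

lemma hdim_objZ (Y : Vtx F r m) (l : ZMod r) (s : ℤ) :
    (hdim Y (objZ F m l s) : ℤ) = arrowsToZ Y l s := by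
  rw [hdim_vtx, card_arrow_Z]

end Arrows

/-! ### Reconstructing an object from dimensions -/

section Reconstruction

variable {F : Type u} {r m : ℕ}

/-- The action of the suspension on the vertices. -/
def shiftVtx : Vtx F r m → Vtx F r m
  | .X k i j h => .X (k + 1) (i + del m k) (j + del m k) (by omega)
  | .Z k i => .Z (k + 1) (i + del m k)

lemma exists_shiftVtx_eq (Y : Vtx F r m) : ∃ Y', shiftVtx Y' = Y := by
  rcases Y with ⟨k, i, j, h⟩ | ⟨k, i⟩
  · exact ⟨.X (k - 1) (i - del m (k - 1)) (j - del m (k - 1)) (by omega), by simp [shiftVtx]⟩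
  · exact ⟨.Z (k - 1) (i - del m (k - 1)), by simp [shiftVtx]⟩

lemma add_one_sub_one_val [NeZero r] {k : ZMod r} (hk : k ≠ 0) : k.val = (k - 1).val + 1 := by
  have hr : r ≠ 1 := by
    rintro rfl
    exact hk (Subsingleton.elim _ _)
  have hpos := ZMod.val_pos.2 hk
  have h1 := ZMod.val_one'' hr
  rw [ZMod.val_sub (by omega), h1]
  omega

/-- A function on vertices which increases along the suspension. -/
def height : Vtx F r m → ℤ
  | .X k i _ _ => r * i + (k - 1).val
  | .Z k i => r * i + (k - 1).val

/-- The representative of `k - 1` grows by one except at `k = 0`, where it wraps around and loses `r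
- 1`; exactly there the lower index grows by `m ≥ 1`, which adds `r * m ≥ r`. -/
lemma height_lt_height_shiftVtx [NeZero r] [NeZero m] (x : Vtx F r m) :
    height x < height (shiftVtx x) := by
  have key (k : ZMod r) (i : ℤ) :
      (r * i + (k - 1).val : ℤ) < r * (i + del m k) + (k + 1 - 1).val := by
    have hr : (0 : ℤ) < r := by exact_mod_cast NeZero.pos r
    by_cases hk : k = 0
    · have h1 : ((k - 1).val : ℤ) < r := by exact_mod_cast ZMod.val_lt (k - 1)
      have h2 : (1 : ℤ) ≤ m := by exact_mod_cast NeZero.pos m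
      simp only [del, if_pos hk]
      have : (0 : ℤ) ≤ ((k + 1 - 1).val : ℤ) := by positivity
      nlinarith
    · rw [add_sub_cancel_right, add_one_sub_one_val hk, del, if_neg hk]
      push_cast
      linarith
  rcases x with ⟨k, i, j, h⟩ | ⟨k, i⟩ <;> exact key k i

/-- A vertex of maximal height in the support within `P` would have its suspension, which is higher,
in the support too. -/
lemma eq_zero_of_add_shiftVtx_eq_zero [NeZero r] [NeZero m] (ν : Vtx F r m →₀ ℤ)
    (P : Vtx F r m → Prop) (hP : ∀ x, P x → P (shiftVtx x))
    (h : ∀ x, P x → ν x + ν (shiftVtx x) = 0) (x : Vtx F r m) (hx : P x) : ν x = 0 := by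
  classical
  by_contra hne
  obtain ⟨y, hy, hmax⟩ := (ν.support.filter P).exists_max_image height
    ⟨x, by simp [hne, hx]⟩
  simp only [Finset.mem_filter, Finsupp.mem_support_iff] at hy hmax
  have := hmax (shiftVtx y) ⟨fun h0 => hy.1 (by simpa [h0] using h y hy.2), hP y hy.2⟩
  exact absurd this (not_le.2 (height_lt_height_shiftVtx y))

/-- The number of arrows from `X_{a,b}^{(k)}` to `v`, which makes sense also if `b < a`. -/
def arrowsFromX (k : ZMod r) (a b : ℤ) : Vtx F r m → ℤ
  | .X l s t _ => (if l = k ∧ a ≤ s ∧ s ≤ b ∧ b ≤ t then 1 else 0) +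
      if l = k + 1 ∧ s ≤ a + del m k - 1 ∧ a + del m k - 1 ≤ t ∧ t ≤ b + del m k - 1 then 1 else 0
  | .Z l s => if l = k ∧ a ≤ s ∧ s ≤ b then 1 else 0

lemma card_arrow_eq_arrowsFromX (k : ZMod r) (a b : ℤ) (h : a ≤ b) (v : Vtx F r m) :
    (Nat.card (Arrow (.X k a b h) v) : ℤ) = arrowsFromX k a b v := by
  rcases v with ⟨l, s, t, hst⟩ | ⟨l, s⟩
  · exact card_arrow_X _ _ _ _ _
  · exact card_arrow_Z _ _ _

open Classical in
-- The degree 0 arrows contribute the vertex itself and the degree 2 arrows its suspension, as mixed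
-- differences of indicators of ranges; the degree 1 arrows into a `Z` cancel.
lemma arrowsFromX_second_difference (k : ZMod r) (i j : ℤ) (h : i ≤ j) (v : Vtx F r m) :
    arrowsFromX k i j v - arrowsFromX k (i + 1) j v - arrowsFromX k i (j + 1) v +
      arrowsFromX k (i + 1) (j + 1) v =
    (if v = .X k i j h then 1 else 0) + if v = shiftVtx (.X k i j h) then 1 else 0 := by
  rcases v with ⟨l, s, t, hst⟩ | ⟨l, s⟩
  · simp only [arrowsFromX, shiftVtx, Vtx.X.injEq]
    have key1 : ((if l = k ∧ i ≤ s ∧ s ≤ j ∧ j ≤ t then 1 else 0) -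
        (if l = k ∧ i + 1 ≤ s ∧ s ≤ j ∧ j ≤ t then 1 else 0) -
        (if l = k ∧ i ≤ s ∧ s ≤ j + 1 ∧ j + 1 ≤ t then 1 else 0) +
        (if l = k ∧ i + 1 ≤ s ∧ s ≤ j + 1 ∧ j + 1 ≤ t then 1 else 0) : ℤ) =
        if l = k ∧ s = i ∧ t = j then 1 else 0 := by
      by_cases hl : l = k <;> simp only [hl, true_and, false_and, if_false] <;>
        [skip; rfl]
      split_ifs <;> omega
    have key2 (c : ℤ) :
        ((if l = k + 1 ∧ s ≤ i + c - 1 ∧ i + c - 1 ≤ t ∧ t ≤ j + c - 1 then 1 else 0) -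
        (if l = k + 1 ∧ s ≤ i + 1 + c - 1 ∧ i + 1 + c - 1 ≤ t ∧ t ≤ j + c - 1 then 1 else 0) -
        (if l = k + 1 ∧ s ≤ i + c - 1 ∧ i + c - 1 ≤ t ∧ t ≤ j + 1 + c - 1 then 1 else 0) +
        (if l = k + 1 ∧ s ≤ i + 1 + c - 1 ∧ i + 1 + c - 1 ≤ t ∧ t ≤ j + 1 + c - 1
          then 1 else 0) : ℤ) =
        if l = k + 1 ∧ s = i + c ∧ t = j + c then 1 else 0 := by
      by_cases hl : l = k + 1 <;> simp only [hl, true_and, false_and, if_false] <;>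
        [skip; rfl]
      split_ifs <;> omega
    linarith [key2 (del m k)]
  · simp only [arrowsFromX, shiftVtx, reduceCtorEq, if_false]
    by_cases hl : l = k <;> simp only [hl, true_and, false_and, if_false] <;>
      [skip; rfl]
    split_ifs <;> omega

lemma linearCombination_ite (ν : Vtx F r m →₀ ℤ) (x : Vtx F r m) [DecidablePred (· = x)] :
    Finsupp.linearCombination ℤ (fun v => if v = x then (1 : ℤ) else 0) ν = ν x := by
  induction ν using Finsupp.induction_linear with
  | zero => simp
  | add f g hf hg => simp [hf, hg]
  | single a b =>
    by_cases h : a = x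
    · subst h; simp
    · simp [h]

/-- A finitely supported function on vertices is determined by its pairings with the numbers of
arrows. -/
lemma eq_zero_of_linearCombination_card_arrow [NeZero r] [NeZero m] (ν : Vtx F r m →₀ ℤ)
    (hν : ∀ Y : Vtx F r m,
      Finsupp.linearCombination ℤ (fun v => (Nat.card (Arrow Y v) : ℤ)) ν = 0) : ν = 0 := by
  classical
  have hfrom (k : ZMod r) (a b : ℤ) (hab : a ≤ b + 1) :
      Finsupp.linearCombination ℤ (arrowsFromX k a b) ν = 0 := by
    -- The boundary case `a = b + 1` occurs as the pair `(i + 1, j)` when `i = j`; there the count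
    -- is identically zero.
    rcases hab.lt_or_eq with h | h
    · rw [← hν (.X k a b (by omega))]
      congr 2
      exact funext fun v => (card_arrow_eq_arrowsFromX k a b _ v).symm
    · have : (arrowsFromX k a b : Vtx F r m → ℤ) = 0 := by
        funext v
        rcases v with ⟨l, s, t, hst⟩ | ⟨l, s⟩
        · simp only [arrowsFromX, Pi.zero_apply]
          rw [if_neg (by omega), if_neg (by omega), add_zero]
        · simp only [arrowsFromX, Pi.zero_apply]
          rw [if_neg (by omega)]
      rw [this]
      simp
  have hlin (f g : Vtx F r m → ℤ) : Finsupp.linearCombination ℤ (f + g) ν =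
      Finsupp.linearCombination ℤ f ν + Finsupp.linearCombination ℤ g ν := by
    simp [Finsupp.linearCombination_apply, Finsupp.sum, mul_add, Finset.sum_add_distrib]
  have hX (k : ZMod r) (i j : ℤ) (h : i ≤ j) : ν (.X k i j h) = 0 := by
    refine eq_zero_of_add_shiftVtx_eq_zero ν (fun x => ∃ k i j h, x = .X k i j h) ?_ ?_ _
      ⟨k, i, j, h, rfl⟩
    · rintro _ ⟨k, i, j, h, rfl⟩
      exact ⟨_, _, _, _, rfl⟩
    · rintro _ ⟨k, i, j, h, rfl⟩
      rw [← linearCombination_ite ν, ← linearCombination_ite ν, ← hlin]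
      have e : (fun v : Vtx F r m => if v = .X k i j h then (1 : ℤ) else 0) +
          (fun v => if v = shiftVtx (.X k i j h) then (1 : ℤ) else 0) +
          (arrowsFromX k (i + 1) j + arrowsFromX k i (j + 1)) =
          arrowsFromX k i j + arrowsFromX k (i + 1) (j + 1) := by
        funext v
        have := arrowsFromX_second_difference k i j h v
        simp only [Pi.add_apply]
        linarith
      have := congrArg (fun f => Finsupp.linearCombination ℤ f ν) e
      simpa only [hlin, hfrom k i j (by omega), hfrom k (i + 1) j (by omega),
        hfrom k i (j + 1) (by omega), hfrom k (i + 1) (j + 1) (by omega), add_zero] using this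
  have hZ (k : ZMod r) (i : ℤ) : ν (.Z k i) = 0 := by
    have h1 := hν (.Z k i)
    have h2 := hν (.Z k (i + 1))
    rw [← linearCombination_ite ν]
    -- The `X` vertices no longer contribute, and on the `Z` vertices the counts from `Z_i` and
    -- `Z_{i+1}` differ only at `Z_i`.
    refine Eq.trans ?_ (sub_eq_zero.2 (h1.trans h2.symm))
    simp only [Finsupp.linearCombination_apply, Finsupp.sum, ← Finset.sum_sub_distrib]
    refine Finset.sum_congr rfl fun v hv => ?_
    rcases v with ⟨l, s, t, hst⟩ | ⟨l, s⟩
    · simp [hX]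
    · rw [card_arrow_Z, card_arrow_Z, ← smul_sub]
      simp only [arrowsToZ, Vtx.Z.injEq]
      congr 1
      by_cases hl : l = k <;> simp only [hl, true_and, false_and, if_false] <;>
        [skip; rfl]
      split_ifs <;> omega
  ext (⟨k, i, j, h⟩ | ⟨k, i⟩)
  · exact hX k i j h
  · exact hZ k i

/-- An object of `C(r, m)` is determined by the dimensions of the spaces of morphisms from the
vertices to it. -/
lemma nonempty_iso_of_hdim_eq [Field F] [NeZero r] [NeZero m] {W W' : CatC F r m}
    (h : ∀ Y : Vtx F r m, hdim Y W = hdim Y W') : Nonempty (W ≅ W') := by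
  apply nonempty_iso_of_multiplicity_eq
  rw [← sub_eq_zero]
  apply eq_zero_of_linearCombination_card_arrow
  intro Y
  have hY : (hdim Y W : ℤ) = hdim Y W' := by rw [h]
  simp only [hdim, Nat.cast_sum] at hY
  simp [hY]

end Reconstruction

/-! ### Ranks on morphism spaces and recognition of cones -/

section Rank

variable {F : Type u} [Field F] {r m : ℕ}

lemma arr_comp_arr_ne_zero_iff {x y z : Vtx F r m} {d e : ℕ} (f : HasArrow x y d)
    (g : HasArrow y z e) : arr (F := F) f ≫ arr g ≠ 0 ↔ HasArrow x z (d + e) := by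
  have h : arr (F := F) f ≫ arr g = mulArrow (F := F) ⟨d, f⟩ ⟨e, g⟩ := by
    change compL x y z (Finsupp.single ⟨d, f⟩ 1) (Finsupp.single ⟨e, g⟩ 1) = _
    rw [compL_single, mul_one, one_smul]
  rw [h]
  by_cases H : HasArrow x z (d + e)
  · have e1 : mulArrow (F := F) ⟨d, f⟩ ⟨e, g⟩ = Finsupp.single ⟨d + e, H⟩ 1 := dif_pos H
    rw [e1]
    exact iff_of_true (Finsupp.single_ne_zero.2 one_ne_zero) H
  · have e1 : mulArrow (F := F) ⟨d, f⟩ ⟨e, g⟩ = 0 := dif_neg H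
    rw [e1]
    exact iff_of_false (fun h => h rfl) H

lemma arrC_comp_arrC_ne_zero_iff {x y z : Vtx F r m} {d e : ℕ} (f : HasArrow x y d)
    (g : HasArrow y z e) : arrC (F := F) f ≫ arrC g ≠ 0 ↔ HasArrow x z (d + e) := by
  rw [← arr_comp_arr_ne_zero_iff f g, ← Functor.map_comp, Ne, Functor.map_eq_zero_iff]

/-- The rank of the map induced by `f : z → B` on the morphisms from the vertex `Y`, provided that
there is at most one arrow `Y → z`. -/
noncomputable def homRank {z : Vtx F r m} {B : CatC F r m} (f : vtx z ⟶ B) (Y : Vtx F r m) : ℕ :=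
  open Classical in if ∃ (d : ℕ) (h : HasArrow Y z d), arrC h ≫ f ≠ 0 then 1 else 0

lemma eq_smul_arr {x y : Vtx F r m} (hxy : ∀ d e, HasArrow x y d → HasArrow x y e → d = e) {d : ℕ}
    (h : HasArrow x y d) (u : x ⟶ y) : ∃ a : F, u = a • arr h := by
  refine ⟨(show Arrow x y →₀ F from u) ⟨d, h⟩, ?_⟩
  change (show Arrow x y →₀ F from u) =
    (show Arrow x y →₀ F from u) ⟨d, h⟩ • Finsupp.single ⟨d, h⟩ (1 : F)
  ext ⟨e, h'⟩
  obtain rfl := hxy _ _ h h'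
  simp

lemma smul_arrC_comp_eq_zero {x y : Vtx F r m} {B : CatC F r m} {d : ℕ} (h : HasArrow x y d)
    (f : vtx y ⟶ B) {a : F} (ha : a ≠ 0)
    (h0 : (Mat_.embedding (Vtx F r m)).map (a • arr h) ≫ f = 0) : arrC h ≫ f = 0 := by
  have e : arrC h =
      (Mat_.embedding (Vtx F r m)).map (a⁻¹ • 𝟙 x) ≫
        (Mat_.embedding (Vtx F r m)).map (a • arr h) := by
    rw [← Functor.map_comp, Linear.smul_comp, Category.id_comp, smul_smul, inv_mul_cancel₀ ha,
      one_smul]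
  rw [e, Category.assoc, h0, comp_zero]

/-- The space `Hom(Y, z)` is zero or a line spanned by the arrow, so composition with `f` is
injective or zero according to what happens to that arrow. -/
lemma card_range_rightComp [Finite F] {z : Vtx F r m} {B : CatC F r m} (f : vtx z ⟶ B)
    (Y : Vtx F r m) (hY : ∀ d e, HasArrow Y z d → HasArrow Y z e → d = e) :
    Nat.card (Preadditive.rightComp (vtx Y) f).range = Nat.card F ^ homRank f Y := by
  by_cases H : ∃ (d : ℕ) (h : HasArrow Y z d), arrC h ≫ f ≠ 0
  · rw [homRank, if_pos H]
    obtain ⟨d, h, hne⟩ := H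
    have hinj : Function.Injective (Preadditive.rightComp (vtx Y) f) := by
      rw [injective_iff_map_eq_zero]
      intro v hv
      obtain ⟨u, rfl⟩ := (Mat_.embedding (Vtx F r m)).map_surjective v
      obtain ⟨a, rfl⟩ := eq_smul_arr hY h u
      by_cases ha : a = 0
      · rw [ha, zero_smul, Functor.map_zero]
      · exact absurd (smul_arrC_comp_eq_zero h f ha hv) hne
    have : Unique (Arrow Y z) :=
      { default := ⟨d, h⟩
        uniq := fun ⟨e, h'⟩ => by
          obtain rfl := hY _ _ h h'
          rfl }
    rw [← Nat.card_congr (AddMonoidHom.ofInjective hinj).toEquiv, card_hom_vtx_vtx,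
      Nat.card_unique (α := Arrow Y z)]
  · rw [homRank, if_neg H, pow_zero]
    push Not at H
    have h0 : Preadditive.rightComp (vtx Y) f = 0 := by
      ext1 v
      obtain ⟨u, rfl⟩ := (Mat_.embedding (Vtx F r m)).map_surjective v
      rw [rightComp_apply, AddMonoidHom.zero_apply]
      by_cases hd : ∃ d, HasArrow Y z d
      · obtain ⟨d, h⟩ := hd
        obtain ⟨a, rfl⟩ := eq_smul_arr hY h u
        by_contra hne
        have e : (Mat_.embedding (Vtx F r m)).map (a • arr h) =
            (Mat_.embedding (Vtx F r m)).map (a • 𝟙 Y) ≫ arrC h := by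
          rw [← Functor.map_comp, Linear.smul_comp, Category.id_comp]
        rw [e, Category.assoc, H d h, comp_zero] at hne
        exact hne rfl
      · have : u = 0 := by
          have : IsEmpty (Arrow Y z) := ⟨fun a => hd ⟨_, a.has⟩⟩
          exact Subsingleton.elim (α := Arrow Y z →₀ F) _ _
        rw [this, Functor.map_zero, zero_comp]
    rw [h0, AddMonoidHom.range_zero]
    exact Nat.card_unique

/-- The dimension count for the third object of an exact triangle that starts in a vertex. -/
lemma hdim_shiftVtx_cone [Finite F] [HasShift (CatC F r m) ℤ]
    [∀ n : ℤ, (shiftFunctor (CatC F r m) n).Additive] [Pretriangulated (CatC F r m)]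
    {z : Vtx F r m} (hz : ∀ (Y : Vtx F r m) (d e), HasArrow Y z d → HasArrow Y z e → d = e)
    {B W : CatC F r m} {f : vtx z ⟶ B} {g : B ⟶ W} {h : W ⟶ (vtx z)⟦(1 : ℤ)⟧}
    (hT : Triangle.mk f g h ∈ distTriang (CatC F r m)) (Y : Vtx F r m)
    (e : (vtx Y)⟦(1 : ℤ)⟧ ≅ vtx (shiftVtx Y)) :
    hdim (shiftVtx Y) W + homRank f (shiftVtx Y) + homRank f Y =
      hdim (shiftVtx Y) B + hdim Y (vtx z) := by
  apply card_pow_injective (F := F)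
  simp only [pow_add, ← card_hom, ← card_range_rightComp f _ (hz _)]
  rw [← card_range_rightComp_congr e f, ← Nat.card_congr (e.homFromEquiv (Z := W)),
    ← Nat.card_congr (e.homFromEquiv (Z := B))]
  exact card_hom_shift_cone hT (vtx Y)

/-- An object with the right dimensions is a cone. -/
lemma isConeOf_of_hdim [NeZero r] [NeZero m] [Finite F] [HasShift (CatC F r m) ℤ]
    [∀ n : ℤ, (shiftFunctor (CatC F r m) n).Additive] [Pretriangulated (CatC F r m)]
    (hX : ∀ (k : ZMod r) (i j : ℤ) (_ : i ≤ j),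
      Nonempty ((objX F m k i j)⟦(1 : ℤ)⟧ ≅ objX F m (k + 1) (i + del m k) (j + del m k)))
    (hZ : ∀ (k : ZMod r) (i : ℤ),
      Nonempty ((objZ F m k i)⟦(1 : ℤ)⟧ ≅ objZ F m (k + 1) (i + del m k)))
    {k : ZMod r} {i : ℤ} {B W : CatC F r m} (f : objZ F m k i ⟶ B)
    (hW : ∀ Y : Vtx F r m, (hdim (shiftVtx Y) W + homRank f (shiftVtx Y) + homRank f Y : ℤ) =
      hdim (shiftVtx Y) B + arrowsToZ Y k i) : IsConeOf f W := by
  obtain ⟨W', g, h, hT⟩ := distinguished_cocone_triangle f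
  have key (Y : Vtx F r m) : hdim Y W' = hdim Y W := by
    -- Every vertex is a suspension, so the dimension count applies to every test vertex.
    obtain ⟨Y, rfl⟩ := exists_shiftVtx_eq Y
    have e : Nonempty ((vtx Y)⟦(1 : ℤ)⟧ ≅ vtx (shiftVtx Y)) := by
      rcases Y with ⟨l, a, b, hab⟩ | ⟨l, a⟩
      · have := hX l a b hab
        rwa [objX, objX, dif_pos hab, dif_pos (by omega)] at this
      · exact hZ l a
    have h1 := hdim_shiftVtx_cone (fun Y => hasArrow_Z_unique Y k i) hT Y e.some
    have h2 := hW Y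
    rw [← hdim_objZ Y k i] at h2
    have h3 : hdim Y (objZ F m k i) = hdim Y (vtx (.Z k i)) := rfl
    omega
  obtain ⟨e⟩ := nonempty_iso_of_hdim_eq key
  -- The chosen triangle on `f` is transported along the isomorphism of third objects.
  exact ⟨g ≫ e.hom, e.inv ≫ h, isomorphic_distinguished _ hT _
    (Triangle.isoMk (Triangle.mk f (g ≫ e.hom) (e.inv ≫ h)) (Triangle.mk f g h)
      (Iso.refl (objZ F m k i)) (Iso.refl B) e.symm
      (by change f ≫ 𝟙 B = 𝟙 _ ≫ f; rw [Category.comp_id, Category.id_comp])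
      (by
        change (g ≫ e.hom) ≫ e.inv = 𝟙 B ≫ g
        rw [Category.assoc, e.hom_inv_id, Category.comp_id, Category.id_comp])
      (by
        change (e.inv ≫ h) ≫ (𝟙 (objZ F m k i))⟦(1 : ℤ)⟧' = e.inv ≫ h
        rw [CategoryTheory.Functor.map_id, Category.comp_id]))⟩

end Rank

/-! ### Telescoping sums of indicators -/

section FinSums

variable {n : ℕ}

lemma cons_castSucc_antitone {s0 : ℤ} {s : Fin n → ℤ} (hs : StrictAnti s) (h0 : ∀ p, s p < s0) :
    StrictAnti (Fin.cons s0 s : Fin (n + 1) → ℤ) := by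
  intro p q hpq
  obtain ⟨q, rfl⟩ := Fin.exists_succ_eq.2 (Fin.ne_zero_of_lt hpq)
  refine Fin.cases ?_ (fun p hpq => ?_) p hpq
  · intro _
    simpa using h0 q
  · simpa using hs (Fin.succ_lt_succ_iff.1 hpq)

lemma sum_cons_castSucc_add (g : ℤ → ℤ) (s0 : ℤ) (s : Fin n → ℤ) :
    ∑ p : Fin n, g ((Fin.cons s0 s : Fin (n + 1) → ℤ) p.castSucc) +
      g ((Fin.cons s0 s : Fin (n + 1) → ℤ) (Fin.last n)) = g s0 + ∑ p, g (s p) := by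
  rw [← Fin.sum_univ_castSucc (fun p => g ((Fin.cons s0 s : Fin (n + 1) → ℤ) p)),
    Fin.sum_univ_succ]
  simp

/-- The `p`-th summand indicates `s_p ≤ x < s_{p-1}` together with `Q p`. These intervals are
disjoint, and the one containing `x` belongs to the least `p` with `s_p ≤ x`; since `Q` passes to
smaller indices, it is enough to test `Q` there. -/
lemma sum_ite_cons_sub {s0 : ℤ} {s : Fin n → ℤ} (hs : StrictAnti s) (h0 : ∀ p, s p < s0)
    {Q : Fin n → Prop} [DecidablePred Q] (hQ : ∀ p q, p ≤ q → Q q → Q p) (x : ℤ) :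
    ∑ p : Fin n, ((if x < (Fin.cons s0 s : Fin (n + 1) → ℤ) p.castSucc ∧ Q p then 1 else 0) -
      (if x < s p ∧ Q p then 1 else 0) : ℤ) =
    if x < s0 ∧ ∃ p, s p ≤ x ∧ Q p then 1 else 0 := by
  set S : Fin (n + 1) → ℤ := Fin.cons s0 s with hS
  have hSa : StrictAnti S := cons_castSucc_antitone hs h0
  have hSs (p : Fin n) : S p.succ = s p := by simp [hS]
  have hS0 : S 0 = s0 := by simp [hS]
  have hlt (p : Fin n) : s p < S p.castSucc := by
    rw [← hSs]; exact hSa p.castSucc_lt_succ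
  have hterm (p : Fin n) : ((if x < S p.castSucc ∧ Q p then 1 else 0) -
      (if x < s p ∧ Q p then 1 else 0) : ℤ) =
      if s p ≤ x ∧ x < S p.castSucc ∧ Q p then 1 else 0 := by
    have := hlt p
    by_cases h : Q p <;> simp only [h, and_true, and_false, if_false, sub_self]
    split_ifs <;> omega
  simp only [hterm]
  by_cases hx : x < s0 ∧ ∃ p, s p ≤ x ∧ Q p
  · rw [if_pos hx]
    obtain ⟨hx0, q, hq, hQq⟩ := hx
    obtain ⟨p0, hp0, hmin⟩ := (Finset.univ.filter fun p => s p ≤ x).exists_min_image id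
      ⟨q, by simpa using hq⟩
    simp only [Finset.mem_filter, Finset.mem_univ, true_and, id] at hp0 hmin
    -- Otherwise the preceding index would also satisfy `s_p ≤ x`, against minimality; for the first
    -- index the bound is `x < s0`.
    have hlt0 : x < S p0.castSucc := by
      by_contra hge
      have hne : p0.castSucc ≠ 0 := by
        intro h
        rw [h, hS0] at hge
        exact hge hx0
      obtain ⟨p1, hp1⟩ := Fin.exists_succ_eq.2 hne
      rw [← hp1, hSs, not_lt] at hge
      have h1 := hmin p1 hge
      have h2 : p1.succ ≤ p1.castSucc := hp1 ▸ Fin.castSucc_le_castSucc_iff.2 h1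
      exact absurd h2 (not_le.2 p1.castSucc_lt_succ)
    rw [Finset.sum_eq_single p0, if_pos ⟨hp0, hlt0, hQ p0 q (hmin q hq) hQq⟩]
    · intro p _ hp
      refine if_neg fun h => ?_
      have h1 : p0 < p := lt_of_le_of_ne (hmin p h.1) (Ne.symm hp)
      have h2 : S p.castSucc ≤ S p0.succ := hSa.antitone (by
        rw [Fin.le_def]
        simpa using h1)
      rw [hSs] at h2
      omega
    · simp
  · rw [if_neg hx]
    refine Finset.sum_eq_zero fun p _ => if_neg fun h => hx ⟨?_, p, h.1, h.2.2⟩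
    have : S p.castSucc ≤ S 0 := hSa.antitone (Fin.zero_le _)
    omega

/-- If `R` holds, so does every `Q p`, and the condition `x < s0` splits into `s_n ≤ x < s0` and `x
< s_n`. This isolates the contribution of the extra component of `fMap'`. -/
lemma ite_or_eq_add {s0 : ℤ} {s : Fin n → ℤ} (hs : StrictAnti s) {Q : Fin n → Prop} [DecidablePred Q]
    {R : Prop} [Decidable R] (hR : ∀ p, R → Q p) (h0 : ∀ p, s p < s0) (x : ℤ) :
    (if x < s0 ∧ ((∃ p, s p ≤ x ∧ Q p) ∨ R) then 1 else 0 : ℤ) =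
    (if x < s0 ∧ ∃ p, s p ≤ x ∧ Q p then 1 else 0) +
      if x < (Fin.cons s0 s : Fin (n + 1) → ℤ) (Fin.last n) ∧ R then 1 else 0 := by
  by_cases h : R
  · have hQ : ∀ p, Q p := fun p => hR p h
    simp only [h, hQ, or_true, and_true]
    rcases n with _ | n
    · simp
    · have e : (Fin.cons s0 s : Fin (n + 1 + 1) → ℤ) (Fin.last (n + 1)) = s (Fin.last n) := by
        rw [← Fin.succ_last, Fin.cons_succ]
      have e2 : (∃ p, s p ≤ x) ↔ s (Fin.last n) ≤ x :=
        ⟨fun ⟨p, hp⟩ => (hs.antitone (Fin.le_last p)).trans hp, fun h => ⟨_, h⟩⟩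
      simp only [e, e2]
      have := h0 (Fin.last n)
      split_ifs <;> omega
  · simp [h]

end FinSums

/-! ### The dimension counts for the two cones -/

section Cones

variable {F : Type u} {r m : ℕ}

/-- An auxiliary indicator, in terms of which the ranks of the maps `fMap` and `fMap'` telescope. -/
def rankTerm (Y : Vtx F r m) (k : ZMod r) (S T : ℤ) : ℤ :=
  match Y with
  | .X k' a b _ => if k = k' ∧ a + del m k - 1 < S ∧ T ≤ b + del m k - 1 then 1 else 0
  | .Z k' a => if k = k' ∧ a + del m k - 1 < S then 1 else 0

/-- With `c = c_k`, `rankTerm Y k S T` is the rank on `Hom(Y, -)` of `α' : Z_{S-c}^{(k)} →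
Z_{T+1-c}^{(k)}`, an arrow that exists precisely when `S ≤ T + 1`. The identity is the dimension
count for its expected cone `X_{S,T}^{(k+1)}`, with `S = T + 1` giving zero. On the right, `S` and
`T` are separated, which is what makes telescoping possible. -/
lemma arrowsToX_add_rankTerm (Y : Vtx F r m) (k : ZMod r) {S T : ℤ} (h : S ≤ T + 1) :
    arrowsToX (shiftVtx Y) (k + 1) S T + rankTerm (shiftVtx Y) k S T + rankTerm Y k S T =
      arrowsToZ (shiftVtx Y) (k + 1) S + arrowsToZ (shiftVtx Y) k (T + 1 - del m k) := by
  rcases Y with ⟨l, a, b, hab⟩ | ⟨l, a⟩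
  · simp only [shiftVtx, arrowsToX, rankTerm, arrowsToZ, add_left_inj]
    have key1 : ((if k = l ∧ a + del m l ≤ S ∧ S ≤ b + del m l ∧ b + del m l ≤ T then 1 else 0) +
        (if k = l ∧ a + del m k - 1 < S ∧ T ≤ b + del m k - 1 then 1 else 0) : ℤ) =
        if k = l ∧ a + del m l ≤ S ∧ S ≤ b + del m l then 1 else 0 := by
      by_cases hk : k = l <;> simp only [hk, true_and, false_and, if_false] <;> [skip; rfl]
      split_ifs <;> omega
    have key2 : ((if k = l + 1 ∧ S ≤ a + del m l + del m (l + 1) - 1 ∧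
          a + del m l + del m (l + 1) - 1 ≤ T ∧ T ≤ b + del m l + del m (l + 1) - 1
          then 1 else 0) +
        (if k = l + 1 ∧ a + del m l + del m k - 1 < S ∧ T ≤ b + del m l + del m k - 1
          then 1 else 0) : ℤ) =
        if k = l + 1 ∧ a + del m l ≤ T + 1 - del m k ∧ T + 1 - del m k ≤ b + del m l
          then 1 else 0 := by
      by_cases hk : k = l + 1 <;> simp only [hk, true_and, false_and, if_false] <;> [skip; rfl]
      split_ifs <;> omega
    linarith
  · simp only [shiftVtx, arrowsToX, rankTerm, arrowsToZ, add_left_inj]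
    have key1 : (if k = l ∧ a + del m k - 1 < S then 1 else 0 : ℤ) =
        if k = l ∧ a + del m l ≤ S then 1 else 0 := by
      by_cases hk : k = l <;> simp only [hk, true_and, false_and, if_false]
      split_ifs <;> omega
    have key2 : ((if k = l + 1 ∧ S ≤ a + del m l + del m (l + 1) - 1 ∧
          a + del m l + del m (l + 1) - 1 ≤ T then 1 else 0) +
        (if k = l + 1 ∧ a + del m l + del m k - 1 < S then 1 else 0) : ℤ) =
        if k = l + 1 ∧ a + del m l ≤ T + 1 - del m k then 1 else 0 := by
      by_cases hk : k = l + 1 <;> simp only [hk, true_and, false_and, if_false] <;> [skip; rfl]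
      split_ifs <;> omega
    linarith

lemma arrowsToZ_shiftVtx (Y : Vtx F r m) (k : ZMod r) (i : ℤ) :
    arrowsToZ (shiftVtx Y) (k + 1) (i + del m k) = arrowsToZ Y k i := by
  rcases Y with ⟨l, a, b, hab⟩ | ⟨l, a⟩ <;> simp only [shiftVtx, arrowsToZ, add_left_inj] <;>
    by_cases hk : k = l <;>
    simp only [hk, true_and, false_and, if_false, add_le_add_iff_right]

/-- The identity behind the dimension counts for both cones. -/
lemma sum_arrowsToX_cons_castSucc {k : ZMod r} {i : ℤ} {n : ℕ} {s t : Fin n → ℤ}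
    (hs_anti : StrictAnti s)
    (hs : ∀ p, s p ≤ i + del m k - 1) (ht : ∀ p, i + del m k - 1 ≤ t p) (Y : Vtx F r m) :
    ∑ p : Fin n, arrowsToX (shiftVtx Y) (k + 1)
        ((Fin.cons (i + del m k) s : Fin (n + 1) → ℤ) p.castSucc) (t p) +
      arrowsToZ (shiftVtx Y) (k + 1) ((Fin.cons (i + del m k) s : Fin (n + 1) → ℤ) (Fin.last n)) +
      ∑ p : Fin n, (rankTerm (shiftVtx Y) k
        ((Fin.cons (i + del m k) s : Fin (n + 1) → ℤ) p.castSucc) (t p) -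
        rankTerm (shiftVtx Y) k (s p) (t p)) +
      ∑ p : Fin n, (rankTerm Y k ((Fin.cons (i + del m k) s : Fin (n + 1) → ℤ) p.castSucc) (t p) -
        rankTerm Y k (s p) (t p)) =
    ∑ p : Fin n, arrowsToX (shiftVtx Y) (k + 1) (s p) (t p) + arrowsToZ Y k i := by
  have h0 (p : Fin n) : s p < i + del m k := by linarith [hs p]
  have htel := sum_cons_castSucc_add (arrowsToZ (shiftVtx Y) (k + 1)) (i + del m k) s
  rw [arrowsToZ_shiftVtx] at htel
  -- The condition holds because `s_{p-1} ≤ s_0 = i + c_k ≤ t_p + 1`; equality is possible and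
  -- corresponds to a zero summand.
  have hterm (p : Fin n) := arrowsToX_add_rankTerm Y k
    (S := (Fin.cons (i + del m k) s : Fin (n + 1) → ℤ) p.castSucc) (T := t p) (by
      have h1 := (cons_castSucc_antitone hs_anti h0).antitone (Fin.zero_le p.castSucc)
      rw [Fin.cons_zero] at h1
      linarith [ht p])
  have hterm' (p : Fin n) := arrowsToX_add_rankTerm Y k (S := s p) (T := t p)
    (by linarith [ht p, hs p])
  have e := Finset.sum_congr (rfl : (Finset.univ : Finset (Fin n)) = _) fun p _ => hterm p
  have e' := Finset.sum_congr (rfl : (Finset.univ : Finset (Fin n)) = _) fun p _ => hterm' p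
  simp only [Finset.sum_add_distrib, Finset.sum_sub_distrib] at e e' ⊢
  linarith

variable [Field F]

lemma comp_fMap_ne_zero_iff {Y : Vtx F r m} {k : ZMod r} {i : ℤ} {n : ℕ} {s t : Fin n → ℤ}
    (hs : ∀ p, s p ≤ i + del m k - 1) (ht : ∀ p, i + del m k - 1 ≤ t p) {d : ℕ}
    (h : HasArrow Y (.Z k i) d) : arrC h ≫ fMap F m k i s t hs ht ≠ 0 ↔
      ∃ p, HasArrow Y (.X (k + 1) (s p) (t p) ((hs p).trans (ht p))) (d + 1) := by
  have hβ (p : Fin n) :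
      HasArrow (F := F) (m := m) (.Z k i) (.X (k + 1) (s p) (t p) ((hs p).trans (ht p))) 1 :=
    ⟨rfl, hs p, ht p⟩
  simp only [← arrC_comp_arrC_ne_zero_iff (F := F) h (hβ _)]
  constructor
  · intro hne
    by_contra hall
    push Not at hall
    refine hne (biproduct.hom_ext _ _ fun p => ?_)
    rw [Category.assoc, fMap, biproduct.lift_π, zero_comp]
    exact hall p
  · rintro ⟨p, hp⟩ h0
    apply hp
    have := congrArg (· ≫ biproduct.π _ p) h0
    simpa only [Category.assoc, fMap, biproduct.lift_π, zero_comp] using this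

lemma comp_fMap'_ne_zero_iff {Y : Vtx F r m} {k : ZMod r} {i j : ℤ} (hj : i ≤ j) {n : ℕ}
    {s t : Fin n → ℤ} (hs : ∀ p, s p ≤ i + del m k - 1) (ht : ∀ p, i + del m k - 1 ≤ t p) {d : ℕ}
    (h : HasArrow Y (.Z k i) d) : arrC h ≫ fMap' F m k i j hj s t hs ht ≠ 0 ↔
      (∃ p, HasArrow Y (.X (k + 1) (s p) (t p) ((hs p).trans (ht p))) (d + 1)) ∨
        HasArrow Y (.Z k j) d := by
  have hα : HasArrow (F := F) (m := m) (.Z k i) (.Z k j) 0 := ⟨rfl, hj⟩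
  have hd : HasArrow Y (.Z k j) d ↔ arrC (F := F) h ≫ arrC hα ≠ 0 :=
    (arrC_comp_arrC_ne_zero_iff (F := F) h hα).symm
  rw [← comp_fMap_ne_zero_iff hs ht h, hd, ← not_and_or, not_iff_not]
  constructor
  · intro h0
    have h1 := congrArg (· ≫ biprod.fst) h0
    have h2 := congrArg (· ≫ biprod.snd) h0
    simp only [Category.assoc, fMap', biprod.lift_fst, biprod.lift_snd, zero_comp] at h1 h2
    exact ⟨h1, h2⟩
  · rintro ⟨h1, h2⟩
    apply biprod.hom_ext
    · rw [Category.assoc, fMap', biprod.lift_fst, zero_comp]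
      exact h1
    · rw [Category.assoc, fMap', biprod.lift_snd, zero_comp]
      exact h2

variable {k : ZMod r} {i : ℤ} {n : ℕ} {s t : Fin n → ℤ}

open Classical in
-- For `Y = X_{a,b}^{(k)}` the rank is 1 exactly when `a + c_k - 1 < s_0` and some `p` has `s_p ≤ a
-- + c_k - 1` and `t_p ≤ b + c_k - 1`; for `Y = Z_a^{(k)}` the condition on `t_p` disappears. As `t`
-- increases, `sum_ite_cons_sub` applies.
lemma homRank_fMap (hs_anti : StrictAnti s) (ht_mono : StrictMono t)
    (hs : ∀ p, s p ≤ i + del m k - 1) (ht : ∀ p, i + del m k - 1 ≤ t p) (Y : Vtx F r m) :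
    (homRank (fMap F m k i s t hs ht) Y : ℤ) =
      ∑ p : Fin n, (rankTerm Y k ((Fin.cons (i + del m k) s : Fin (n + 1) → ℤ) p.castSucc) (t p) -
        rankTerm Y k (s p) (t p)) := by
  have h0 (p : Fin n) : s p < i + del m k := by linarith [hs p]
  simp only [homRank, comp_fMap_ne_zero_iff, exists_prop, Nat.cast_ite, Nat.cast_one,
    Nat.cast_zero]
  rcases Y with ⟨l, a, b, hab⟩ | ⟨l, a⟩
  · by_cases hk : k = l
    · subst hk
      simp only [rankTerm, true_and]
      rw [sum_ite_cons_sub hs_anti h0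
        (fun p q hpq h => (ht_mono.monotone hpq).trans h) (a + del m k - 1)]
      refine if_congr ?_ rfl rfl
      constructor
      · rintro ⟨d, h1, p, h2⟩
        rcases d with _ | _ | d <;> simp only [HasArrow] at h1 h2
        exact ⟨by omega, p, by omega, by omega⟩
      -- The remaining inequalities follow from `a ≤ i` and `i + c_k - 1 ≤ t_p`; the arrow into
      -- `Z_i` is `β`, of degree 1.
      · rintro ⟨hx, p, h1, h2⟩
        have := ht p
        exact ⟨1, ⟨rfl, by omega, by omega⟩, p, rfl, by omega, by omega, by omega⟩
    · simp only [rankTerm, hk, false_and, if_false, sub_self, Finset.sum_const_zero]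
      refine if_neg ?_
      rintro ⟨d, h1, -⟩
      rcases d with _ | _ | d <;> simp only [HasArrow] at h1
      exact hk h1.1
  · by_cases hk : k = l
    · subst hk
      simp only [rankTerm, true_and]
      have := sum_ite_cons_sub (Q := fun _ => True) hs_anti h0 (fun _ _ _ h => h)
        (a + del m k - 1)
      simp only [and_true] at this
      rw [this]
      refine if_congr ?_ rfl rfl
      constructor
      · rintro ⟨d, h1, p, h2⟩
        rcases d with _ | d <;> simp only [HasArrow] at h1 h2
        exact ⟨by omega, p, by omega⟩
      · rintro ⟨hx, p, h1⟩
        have := ht p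
        exact ⟨0, ⟨rfl, by omega⟩, p, rfl, by omega, by omega⟩
    · simp only [rankTerm, hk, false_and, if_false, sub_self, Finset.sum_const_zero]
      refine if_neg ?_
      rintro ⟨d, h1, -⟩
      rcases d with _ | d <;> simp only [HasArrow] at h1
      exact hk h1.1

open Classical in
lemma homRank_fMap' {j : ℤ} (hj : i ≤ j) (hs_anti : StrictAnti s)
    (hs : ∀ p, s p ≤ i + del m k - 1) (ht : ∀ p, i + del m k - 1 ≤ t p)
    (htj : ∀ p, t p < j + del m k - 1) (Y : Vtx F r m) :
    (homRank (fMap' F m k i j hj s t hs ht) Y : ℤ) = homRank (fMap F m k i s t hs ht) Y +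
      rankTerm Y k ((Fin.cons (i + del m k) s : Fin (n + 1) → ℤ) (Fin.last n))
        (j + del m k - 1) := by
  have h0 (p : Fin n) : s p < i + del m k := by linarith [hs p]
  simp only [homRank, comp_fMap_ne_zero_iff, comp_fMap'_ne_zero_iff, exists_prop, Nat.cast_ite,
    Nat.cast_one, Nat.cast_zero]
  rcases Y with ⟨l, a, b, hab⟩ | ⟨l, a⟩
  · by_cases hk : k = l
    · subst hk
      simp only [rankTerm, true_and]
      -- Here `R` says `j ≤ b`, so that the composite with `α'` is an arrow; it implies each `Q p`
      -- because `t_p < j + c_k - 1`.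
      have := ite_or_eq_add (Q := fun p => t p ≤ b + del m k - 1)
        (R := j + del m k - 1 ≤ b + del m k - 1) hs_anti
        (fun p h => (htj p).le.trans h) h0 (a + del m k - 1)
      refine Eq.trans (if_congr ?_ rfl rfl)
        (this.trans (congrArg (· + _) (if_congr (Iff.symm ?_) rfl rfl)))
      · refine ⟨?_, ?_⟩
        · rintro ⟨d, h1, ⟨p, h2⟩ | h2⟩
          · rcases d with _ | _ | d <;> simp only [HasArrow] at h1 h2
            exact ⟨by omega, Or.inl ⟨p, by omega, by omega⟩⟩
          · rcases d with _ | _ | d <;> simp only [HasArrow] at h1 h2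
            exact ⟨by omega, Or.inr (by omega)⟩
        · rintro ⟨hx, ⟨p, h1, h2⟩ | h2⟩
          · have := ht p
            exact ⟨1, ⟨rfl, by omega, by omega⟩, Or.inl ⟨p, rfl, by omega, by omega, by omega⟩⟩
          · exact ⟨1, ⟨rfl, by omega, by omega⟩, Or.inr ⟨rfl, by omega, by omega⟩⟩
      · refine ⟨?_, ?_⟩
        · rintro ⟨d, h1, p, h2⟩
          rcases d with _ | _ | d <;> simp only [HasArrow] at h1 h2
          exact ⟨by omega, p, by omega, by omega⟩
        · rintro ⟨hx, p, h1, h2⟩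
          have := ht p
          exact ⟨1, ⟨rfl, by omega, by omega⟩, p, rfl, by omega, by omega, by omega⟩
    · simp only [rankTerm, hk, false_and, if_false, add_zero]
      refine if_congr ⟨?_, ?_⟩ rfl rfl
      all_goals
        rintro ⟨d, h1, -⟩
        rcases d with _ | _ | d <;> simp only [HasArrow] at h1
        exact absurd h1.1 hk
  · by_cases hk : k = l
    · subst hk
      simp only [rankTerm, true_and]
      -- From a `Z` vertex the composite with `α'` never vanishes.
      have := ite_or_eq_add (Q := fun _ : Fin n => True) (R := True) hs_anti
        (fun p h => h) h0 (a + del m k - 1)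
      simp only [and_true, or_true] at this
      refine Eq.trans (if_congr ?_ rfl rfl)
        (this.trans (congrArg (· + _) (if_congr (Iff.symm ?_) rfl rfl)))
      · refine ⟨?_, ?_⟩
        · rintro ⟨d, h1, -⟩
          rcases d with _ | d <;> simp only [HasArrow] at h1
          omega
        · intro hx
          exact ⟨0, ⟨rfl, by omega⟩, Or.inr ⟨rfl, by omega⟩⟩
      · refine ⟨?_, ?_⟩
        · rintro ⟨d, h1, p, h2⟩
          rcases d with _ | d <;> simp only [HasArrow] at h1 h2
          exact ⟨by omega, p, by omega⟩
        · rintro ⟨hx, p, h1⟩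
          have := ht p
          exact ⟨0, ⟨rfl, by omega⟩, p, rfl, by omega, by omega⟩
    · simp only [rankTerm, hk, false_and, if_false, add_zero]
      refine if_congr ⟨?_, ?_⟩ rfl rfl
      all_goals
        rintro ⟨d, h1, -⟩
        rcases d with _ | d <;> simp only [HasArrow] at h1
        exact absurd h1.1 hk

end Cones

end DiscreteHall

/-! ### The two cones -/

open DiscreteHall in
theorem mainTheorem6 {F : Type*} [Field F] [Finite F] (r m : ℕ) [NeZero r] [NeZero m]
    [HasShift (CatC F r m) ℤ] [∀ n : ℤ, (shiftFunctor (CatC F r m) n).Additive]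
    [Pretriangulated (CatC F r m)] [IsTriangulated (CatC F r m)]
    (hX : ∀ (k : ZMod r) (i j : ℤ) (h : i ≤ j),
      Nonempty ((objX F m k i j)⟦(1 : ℤ)⟧ ≅ objX F m (k + 1) (i + del m k) (j + del m k)))
    (hZ : ∀ (k : ZMod r) (i : ℤ),
      Nonempty ((objZ F m k i)⟦(1 : ℤ)⟧ ≅ objZ F m (k + 1) (i + del m k)))
    (k : ZMod r) (i : ℤ) (n : ℕ) (s t : Fin n → ℤ) (hs_anti : StrictAnti s) (ht_mono : StrictMono t)
    (hs : ∀ p, s p ≤ i + del m k - 1) (ht : ∀ p, i + del m k - 1 ≤ t p) :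
    -- `Fin.cons (i + del m k) s` is the sequence `s_0, s_1, …, s_n`
    IsConeOf (fMap F m k i s t hs ht)
      ((⨁ fun p : Fin n => objX F m (k + 1)
          ((Fin.cons (i + del m k) s : Fin (n + 1) → ℤ) p.castSucc) (t p)) ⊞
        objZ F m (k + 1) ((Fin.cons (i + del m k) s : Fin (n + 1) → ℤ) (Fin.last n))) ∧
    -- `Fin.snoc t (j + del m k - 1)` is the sequence `t_1, …, t_n, t_{n+1}`
    ∀ (j : ℤ) (hj : i ≤ j), (∀ p, t p < j + del m k - 1) →
      IsConeOf (fMap' F m k i j hj s t hs ht)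
        (⨁ fun p : Fin (n + 1) => objX F m (k + 1)
          ((Fin.cons (i + del m k) s : Fin (n + 1) → ℤ) p)
          ((Fin.snoc t (j + del m k - 1) : Fin (n + 1) → ℤ) p)) := by
  have hsum (Y : Vtx F r m) : (hdim Y (sumX F m k s t fun p => (hs p).trans (ht p)) : ℤ) =
      ∑ p, arrowsToX Y (k + 1) (s p) (t p) := by
    rw [hdim_biproduct, Nat.cast_sum]
    refine Finset.sum_congr rfl fun p _ => ?_
    rw [hdim_vtx, card_arrow_X]
  refine ⟨isConeOf_of_hdim hX hZ _ fun Y => ?_, fun j hj htj =>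
    isConeOf_of_hdim hX hZ _ fun Y => ?_⟩
  · rw [hdim_biprod, hdim_biproduct, Nat.cast_add, Nat.cast_sum, hsum, hdim_objZ,
      homRank_fMap hs_anti ht_mono, homRank_fMap hs_anti ht_mono]
    simp only [hdim_objX]
    exact sum_arrowsToX_cons_castSucc hs_anti hs ht Y
  · rw [hdim_biprod, hdim_biproduct, Nat.cast_add, Nat.cast_sum, hsum, hdim_objZ,
      homRank_fMap' hj hs_anti hs ht htj, homRank_fMap' hj hs_anti hs ht htj,
      homRank_fMap hs_anti ht_mono, homRank_fMap hs_anti ht_mono]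
    simp only [hdim_objX, Fin.sum_univ_castSucc (n := n), Fin.snoc_castSucc, Fin.snoc_last]
    have h0 (p : Fin n) : s p < i + del m k := by linarith [hs p]
    -- The instance `(s_n, t_{n+1})` trades the summand `Z_{s_n}^{(k+1)}` of the first cone for
    -- `X_{s_n,t_{n+1}}^{(k+1)}`. Since `t_{n+1} + 1 - c_k = j`, its other term accounts for the new
    -- summand `Z_j^{(k)}` of the target.
    have h1 := arrowsToX_add_rankTerm Y k
      (S := (Fin.cons (i + del m k) s : Fin (n + 1) → ℤ) (Fin.last n)) (T := j + del m k - 1) (by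
        have h1 := (cons_castSucc_antitone hs_anti h0).antitone (Fin.zero_le (Fin.last n))
        rw [Fin.cons_zero] at h1
        linarith)
    rw [show j + del m k - 1 + 1 - del m k = j by ring] at h1
    linarith [sum_arrowsToX_cons_castSucc hs_anti hs ht Y]
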